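/- Let $\mathcal{M}=(V,\mathcal{I})$ be a matroid on a finite ground set $V$. Let $U$ be a universe with a weight function $w:U\to\mathbb{R}_{\ge 0}$, let $\{U_v\}_{v\in V}$ be a family of finite subsets of $U$, and let $$f(S)=\sum_{u\in\bigcup_{s\in S}U_s}w(u)\qquad(S\subseteq V)$$ be the associated coverage function. Let $\mu\ge 0$ be an integer such that $f$ has frequency bounded by $\mu$, that is, every $u\in U$ belongs to at most $\mu$ of the sets $U_v$, $v\in V$. Let $\rho\ge 1$ be an integer and let $\rho\mathcal{M}=(V,\mathcal{I}_\rho)$ be the union of $\rho$ copies of $\mathcal{M}$: $S\in\mathcal{I}_\rho$ if and only if $S$ can be partitioned into $\rho$ (possibly empty) sets $S_1,\dots,S_\rho\in\mathcal{I}$. Let $V'\in\mathcal{I}_\rho$ be a maximum-weight independent set of $\rho\mathcal{M}$ with respect to the weights $f(\{v\})$, that is, $\sum_{v\in V'}f(\{v\})\ge\sum_{v\in T}f(\{v\})$ for every $T\in\mathcal{I}_\rho$. Then there is a set $S\subseteq V'$ with $S\in\mathcal{I}$ and $$f(S)\ \ge\ \Bigl(1-\frac{\mu-1}{\rho}\Bigr)\cdot\max_{T\in\mathcal{I}}f(T).$$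 -/

import Mathlib

namespace MatroidCoverage

/-- The coverage function `f(S) = w(⋃_{s ∈ S} U_s)` of a family `U` of subsets of a universe `β`
with weights `w`. -/
noncomputable def coverage {α β : Type*} (U : α → Finset β) (w : β → ℝ) (S : Finset α) : ℝ :=
  open Classical in ∑ u ∈ S.biUnion U, w u

/-- Every element of the universe lies in at most `μ` of the sets `U v`, `v` in the ground set. -/
def FrequencyBounded {α β : Type*} (M : Matroid α) (U : α → Finset β) (μ : ℕ) : Prop :=
  ∀ u : β, {v ∈ M.E | u ∈ U v}.encard ≤ μ

/-- `S` is independent in the union of `ρ` copies of `M`: it can be partitioned into `ρ`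
(possibly empty) independent sets of `M`. -/
def UnionIndep {α : Type*} (M : Matroid α) (ρ : ℕ) (S : Set α) : Prop :=
  ∃ P : Fin ρ → Set α,
    Pairwise (fun i j => Disjoint (P i) (P j)) ∧ ⋃ i, P i = S ∧ ∀ i, M.Indep (P i)

/-- `S` belongs to the family `Ind` and has maximum total weight among its finite members. -/
def IsMaxWeight {α : Type*} (Ind : Set α → Prop) (c : α → ℝ) (S : Finset α) : Prop :=
  Ind S ∧ ∀ T : Finset α, Ind T → ∑ v ∈ T, c v ≤ ∑ v ∈ S, c v

/-- `S` is a feasible solution of `max {f T : T independent in M}` whose value is at least `r`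
times the optimum (the optimum being attained). -/
def IsApproxSolution {α : Type*} (M : Matroid α) (f : Finset α → ℝ) (r : ℝ) (S : Finset α) :
    Prop :=
  M.Indep (S : Set α) ∧
    ∃ opt : ℝ, IsGreatest {x | ∃ T : Finset α, M.Indep (T : Set α) ∧ f T = x} opt ∧
      r * opt ≤ f S

end MatroidCoverage

/-! Fix an optimal independent set `O` and put `r = 1 - (μ - 1) / ρ`. If `r ≤ 0` the empty set
suffices, so let `r ≥ 0`. Maximality of `V'` yields `ρ` independent sets `B i ⊆ V'`, all containing
`O ∩ V'` and pairwise disjoint off `O`, whose parts off `O` weigh on average at least as much as `O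
\ V'` (`IsMaxWeight.exists_replacements`). The average `x` of their indicators is 1 on `O ∩ V'`, 0
on `O \ V'` and at most `1 / ρ` off `O`.

Include each `v` independently with probability `x v`. By the frequency bound, `u` is then covered
with probability at least `r` times the following: 1 if `O` covers `u`, plus the expected number of
sets off `O` containing `u`, minus the number from `O \ V'` containing `u` (`element_estimate`).
Summed with weights, the last two terms contribute a nonnegative amount, so the multilinear
extension at `x` is at least `r * f(O)`.

Finally `x` lies below an average of bases of `M` restricted to `V'`. Convexity along exchange
directions merges these bases into a single one without loss (`exists_rounding`); this is swap
rounding. -/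

open Set

namespace MatroidCoverage

/-! ### Matroid union -/

section Union

variable {α : Type*} {M : Matroid α} {ρ : ℕ}

theorem UnionIndep.subset {S T : Set α} (hT : UnionIndep M ρ T) (hST : S ⊆ T) :
    UnionIndep M ρ S := by
  obtain ⟨P, hd, rfl, hP⟩ := hT
  refine ⟨fun i => P i ∩ S, fun i j hij => (hd hij).mono inter_subset_left inter_subset_left, ?_,
    fun i => (hP i).subset inter_subset_left⟩
  rw [← iUnion_inter, inter_eq_right]
  exact hST

theorem UnionIndep.subset_ground {S : Set α} (hS : UnionIndep M ρ S) : S ⊆ M.E := by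
  obtain ⟨P, -, rfl, hP⟩ := hS
  exact iUnion_subset fun i => (hP i).subset_ground

theorem unionIndep_empty (M : Matroid α) (ρ : ℕ) : UnionIndep M ρ ∅ :=
  ⟨fun _ => ∅, fun _ _ _ => disjoint_bot_left, by simp, fun _ => M.empty_indep⟩

theorem ncard_iUnion_fin {P : Fin ρ → Set α} (hfin : ∀ i, (P i).Finite)
    (hd : Pairwise (fun i j => Disjoint (P i) (P j))) :
    (⋃ i, P i).ncard = ∑ i, (P i).ncard := by
  classical
  have h : (⋃ i, P i) = ((Finset.univ.biUnion fun i => (hfin i).toFinset : Finset α) : Set α) := by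
    ext; simp
  rw [h, ncard_coe_finset, Finset.card_biUnion]
  · exact Finset.sum_congr rfl fun i _ => (ncard_eq_toFinset_card _ (hfin i)).symm
  · intro i _ j _ hij
    simpa using hd hij

/-- The augmentation property for the union of `ρ` copies of a finite matroid. -/
theorem UnionIndep.augment [M.Finite] {I J : Set α} (hI : UnionIndep M ρ I)
    (hJ : UnionIndep M ρ J) (hIJ : I.ncard < J.ncard) :
    ∃ e ∈ J, e ∉ I ∧ UnionIndep M ρ (insert e I) := by
  classical
  obtain ⟨Q, hdQ, rfl, hQ⟩ := hJ
  obtain ⟨P, hdP, hPI, hP⟩ := hI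
  have hfin : ∀ {X : Set α}, M.Indep X → X.Finite := fun h => M.ground_finite.subset h.subset_ground
  induction hn : ∑ i, (Q i \ P i).ncard using Nat.strong_induction_on generalizing P with
  | _ n ih =>
  obtain ⟨i, hi⟩ : ∃ i, (P i).ncard < (Q i).ncard := by
    by_contra! hcon
    rw [← hPI, ncard_iUnion_fin (fun i => hfin (hP i)) hdP,
      ncard_iUnion_fin (fun i => hfin (hQ i)) hdQ] at hIJ
    exact absurd hIJ (not_lt.2 (Finset.sum_le_sum fun i _ => hcon i))
  obtain ⟨x, hx, hxi⟩ := (hP i).augment (hQ i) (by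
    rw [← (hfin (hP i)).cast_ncard_eq, ← (hfin (hQ i)).cast_ncard_eq]
    exact_mod_cast hi)
  -- Transfer `x` to part `i`, removing it from any other part.
  have hdPx : Pairwise fun j k => Disjoint (if j = i then insert x (P i) else P j \ {x})
      (if k = i then insert x (P i) else P k \ {x}) := by
    intro j k hjk
    have hjk' : Disjoint (P j) (P k) := hdP hjk
    rw [Set.disjoint_left] at hjk' ⊢
    intro y hy hy'
    split_ifs at hy hy' <;> grind
  have hU : ⋃ j, (if j = i then insert x (P i) else P j \ {x}) = insert x I := by
    rw [← hPI]
    ext y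
    simp only [mem_iUnion, mem_insert_iff]
    constructor
    · rintro ⟨j, hj⟩
      split_ifs at hj with h
      · rcases hj with hj | hj
        · exact Or.inl hj
        · exact Or.inr ⟨i, hj⟩
      · exact Or.inr ⟨j, hj.1⟩
    · rintro (rfl | ⟨j, hj⟩)
      · exact ⟨i, by simp⟩
      · by_cases hji : j = i
        · subst hji; exact ⟨j, by simp [hj]⟩
        · by_cases hyx : y = x
          · exact ⟨i, by simp [hyx]⟩
          · exact ⟨j, by simp [hji, hj, hyx]⟩
  have hPx : ∀ j, M.Indep (if j = i then insert x (P i) else P j \ {x}) := by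
    intro j
    split_ifs
    · exact hxi
    · exact (hP j).subset sdiff_subset
  by_cases hxI : x ∈ I
  · rw [insert_eq_of_mem hxI] at hU
    refine ih _ ?_ _ hdPx hU hPx rfl
    rw [← hn]
    -- The transfer brings `P` closer to `Q`: `x` lies in `Q i` alone, so taking it out of another
    -- part costs nothing there.
    have hxQ : ∀ j, j ≠ i → x ∉ Q j := fun j hj hxj =>
      Set.disjoint_left.1 (hdQ hj) hxj hx.1
    refine Finset.sum_lt_sum (fun j _ => ncard_le_ncard ?_ ((hfin (hQ j)).sdiff))
      ⟨i, Finset.mem_univ _, ncard_lt_ncard ⟨?_, ?_⟩ ((hfin (hQ i)).sdiff)⟩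
    · intro y hy
      split_ifs at hy <;> grind
    · intro y hy
      simp only [if_pos] at hy
      grind
    · intro h
      have := h hx
      simp at this
  · exact ⟨x, mem_iUnion.2 ⟨i, hx.1⟩, hxI, _, hdPx, hU, hPx⟩

/-- The union of `ρ` copies of a finite matroid. -/
def unionMatroid (M : Matroid α) [M.Finite] (ρ : ℕ) : Matroid α :=
  (IndepMatroid.ofFinite M.ground_finite (UnionIndep M ρ) (unionIndep_empty M ρ)
    (fun _ _ hJ hIJ => hJ.subset hIJ) (fun _ _ hI hJ h => hI.augment hJ h)
    (fun _ hI => hI.subset_ground)).matroid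

@[simp] theorem unionMatroid_indep_iff [M.Finite] {I : Set α} :
    (unionMatroid M ρ).Indep I ↔ UnionIndep M ρ I := Iff.rfl

end Union

/-! ### Exchange and maximum weight -/

section Exchange

variable {α : Type*} {M : Matroid α}

/-- Symmetric basis exchange. -/
theorem symmetric_exchange {B₁ B₂ : Set α} (h₁ : M.IsBase B₁) (h₂ : M.IsBase B₂) {e : α}
    (he : e ∈ B₁ \ B₂) : ∃ f ∈ B₂ \ B₁, M.IsBase (insert f (B₁ \ {e})) ∧
      M.IsBase (insert e (B₂ \ {f})) := by
  have heE : e ∈ M.E := h₁.subset_ground he.1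
  have hecl : e ∈ M.closure B₂ := by rw [h₂.closure_eq]; exact heE
  have hC := h₂.fundCircuit_isCircuit heE he.2
  -- Otherwise the rest of the circuit, and hence `e`, would be spanned by `B₁ \ {e}`.
  obtain ⟨f, hfC, hf⟩ : ∃ f ∈ M.fundCircuit e B₂ \ {e}, f ∉ M.closure (B₁ \ {e}) := by
    by_contra! hcon
    refine h₁.indep.notMem_closure_sdiff_of_mem he.1 ?_
    exact M.closure_subset_closure_of_subset_closure hcon
      (hC.mem_closure_sdiff_singleton_of_mem (M.mem_fundCircuit e B₂))
  have hfB₂ : f ∈ B₂ := ((M.fundCircuit_subset_insert e B₂) hfC.1).resolve_left hfC.2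
  have hfB₁ : f ∉ B₁ := fun h => hf (M.mem_closure_of_mem' ⟨h, hfC.2⟩ (h₁.subset_ground h))
  refine ⟨f, ⟨hfB₂, hfB₁⟩, h₁.exchange_base_of_notMem_closure he.1 hf (h₂.subset_ground hfB₂), ?_⟩
  have hi := (h₂.indep.mem_fundCircuit_iff hecl he.2).1 hfC.1
  rw [insert_sdiff_singleton_comm (Ne.symm hfC.2)]
  exact h₂.exchange_isBase_of_indep' hfB₂ he.2 hi

/-- An element outside a maximum-weight member of the union of `ρ` copies of `M` is spanned by the
members of at least its own weight. -/
theorem IsMaxWeight.not_unionIndep_insert [M.Finite] {ρ : ℕ} {c : α → ℝ} {V' : Finset α}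
    (hV' : IsMaxWeight (UnionIndep M ρ) c V') {o : α} (ho : o ∉ V') (hco : 0 < c o) :
    ¬ UnionIndep M ρ (insert o {v | v ∈ V' ∧ c o ≤ c v}) := by
  classical
  intro hH
  have hVi : (unionMatroid M ρ).Indep (V' : Set α) := hV'.1
  have hoE : o ∈ (unionMatroid M ρ).E := hH.subset_ground (mem_insert _ _)
  have hoV : o ∉ (V' : Set α) := by simpa using ho
  have hocl : o ∈ (unionMatroid M ρ).closure (V' : Set α) := by
    by_contra hcl
    have h := (hVi.notMem_closure_iff_of_notMem hoV hoE).1 hcl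
    have h' := hV'.2 (insert o V') (by simpa using h)
    rw [Finset.sum_insert ho] at h'
    linarith
  have hC := hVi.fundCircuit_isCircuit hocl hoV
  -- If the set were independent, the fundamental circuit of `o` would contain some `v` lighter than
  -- `o`, and swapping the two would increase the weight of `V'`.
  obtain ⟨v, hvC, hv⟩ : ∃ v ∈ (unionMatroid M ρ).fundCircuit o V',
      v ∉ (insert o {v | v ∈ V' ∧ c o ≤ c v} : Set α) := by
    by_contra! hcon
    exact hC.not_indep ((unionMatroid_indep_iff.2 hH).subset hcon)
  have hvo : v ≠ o := fun h => hv (h ▸ mem_insert _ _)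
  have hvV : v ∈ V' := by
    simpa using (((unionMatroid M ρ).fundCircuit_subset_insert o V') hvC).resolve_left hvo
  have hcv : c v < c o := by
    by_contra! h
    exact hv (Or.inr ⟨hvV, h⟩)
  have hi := (hVi.mem_fundCircuit_iff hocl hoV).1 hvC
  rw [← insert_sdiff_singleton_comm hvo.symm] at hi
  have h' := hV'.2 (insert o (V'.erase v)) (by simpa using hi)
  rw [Finset.sum_insert (by simp [ho])] at h'
  have := Finset.add_sum_erase V' c hvV
  linarith

end Exchange

/-! ### Replacing `O` by members of `V'` -/

section Representatives

variable {α : Type*} {M : Matroid α} {ρ : ℕ}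

/-- The matroid with `ρ` parallel copies of every element of `M`. -/
def parallelCopies (M : Matroid α) (ρ : ℕ) : Matroid (α × Fin ρ) := M.comap Prod.fst

theorem parallelCopies_indep_iff {I : Set (α × Fin ρ)} :
    (parallelCopies M ρ).Indep I ↔ M.Indep (Prod.fst '' I) ∧ InjOn Prod.fst I := Iff.rfl

instance parallelCopies_finite [M.Finite] : (parallelCopies M ρ).Finite := by
  refine ⟨(M.ground_finite.prod (finite_univ (α := Fin ρ))).subset ?_⟩
  intro p hp
  exact ⟨hp, mem_univ _⟩

theorem UnionIndep.image_fst {I : Set (α × Fin ρ)} {σ : ℕ}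
    (hI : UnionIndep (parallelCopies M ρ) σ I) (hinj : InjOn Prod.fst I) :
    UnionIndep M σ (Prod.fst '' I) := by
  obtain ⟨P, hd, rfl, hP⟩ := hI
  refine ⟨fun i => Prod.fst '' P i, fun i j hij => ?_, (image_iUnion).symm, fun i => (hP i).1⟩
  have hij' : Disjoint (P i) (P j) := hd hij
  refine Set.disjoint_left.2 ?_
  rintro _ ⟨p, hp, rfl⟩ ⟨q, hq, h⟩
  have hqp := hinj (mem_iUnion.2 ⟨j, hq⟩) (mem_iUnion.2 ⟨i, hp⟩) h
  exact Set.disjoint_left.1 hij' hp (hqp ▸ hq)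

/-- Each layer `I ×ˢ {i}` is one part. This is the starting point of the exchanges in
`IsMaxWeight.exists_heavy_unionIndep`. -/
theorem unionIndep_prod_univ {I : Set α} (hI : M.Indep I) :
    UnionIndep (parallelCopies M ρ) ρ (I ×ˢ (univ : Set (Fin ρ))) := by
  refine ⟨fun i => I ×ˢ {i}, fun i j hij => ?_, ?_, fun i => ?_⟩
  · refine Set.disjoint_left.2 ?_
    rintro ⟨a, b⟩ h h'
    exact hij (h.2.symm.trans h'.2)
  · ext ⟨a, b⟩
    simp
  · rw [parallelCopies_indep_iff]
    refine ⟨hI.subset ?_, ?_⟩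
    · rintro _ ⟨⟨a, b⟩, h, rfl⟩
      exact h.1
    · rintro ⟨a, b⟩ h ⟨a', b'⟩ hq heq
      exact Prod.ext heq (h.2.trans hq.2.symm)

/-- A copy of an element outside a maximum-weight set is spanned, in the union of `ρ` copies, by the
members of the set of at least its own weight. -/
theorem IsMaxWeight.mem_closure [M.Finite] {c : α → ℝ} {V' : Finset α}
    (hV' : IsMaxWeight (UnionIndep M ρ) c V') {o : α} (hoE : o ∈ M.E) (ho : o ∉ V')
    (hco : 0 < c o) (k z : Fin ρ) :
    (o, k) ∈ (unionMatroid (parallelCopies M ρ) ρ).closure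
      ((fun v => (v, z)) '' {v | v ∈ V' ∧ c o ≤ c v}) := by
  set H : Set α := {v | v ∈ V' ∧ c o ≤ c v} with hHdef
  set N := unionMatroid (parallelCopies M ρ) ρ
  have hH : UnionIndep M ρ H := hV'.1.subset fun v hv => by simpa using hv.1
  have hHN : N.Indep ((fun v => (v, z)) '' H) := by
    obtain ⟨P, hd, hU, hP⟩ := hH
    refine ⟨fun i => (fun v => (v, z)) '' P i, fun i j hij => ?_, ?_, fun i => ?_⟩
    · exact (disjoint_image_iff (Prod.mk_left_injective z)).2 (hd hij)
    · rw [← hU, image_iUnion]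
    · rw [parallelCopies_indep_iff, image_image]
      refine ⟨by simpa using hP i, ?_⟩
      rintro _ ⟨a, -, rfl⟩ _ ⟨b, -, rfl⟩ h
      exact Prod.ext h rfl
  by_contra hcl
  have hok : (o, k) ∉ (fun v => (v, z)) '' H := by
    rintro ⟨v, hv, h⟩
    have hvo : v = o := congrArg Prod.fst h
    exact ho (hvo ▸ hv.1)
  have hi : UnionIndep (parallelCopies M ρ) ρ _ :=
    (hHN.notMem_closure_iff_of_notMem hok (show (o, k) ∈ N.E from hoE)).1 hcl
  refine hV'.not_unionIndep_insert ho hco ?_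
  have := hi.image_fst ?_
  · simpa [image_insert_eq, image_image] using this
  · rintro _ (rfl | ⟨a, ha, rfl⟩) _ (rfl | ⟨b, hb, rfl⟩) h
    · rfl
    · exact absurd hb.1 (by rw [← show o = b from h]; exact ho)
    · exact absurd ha.1 (by rw [show a = o from h]; exact ho)
    · exact Prod.ext h rfl

/-- Among the independent sets of the union of `ρ` copies that contain all copies of `O ∩ V'` there
is one that, up to elements of weight zero, lies in `V'` outside these copies, and is at least as
heavy as all copies of `O`. -/
theorem IsMaxWeight.exists_heavy_unionIndep [M.Finite] {c : α → ℝ} (hc : ∀ v, 0 ≤ c v)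
    {V' : Finset α} (hV' : IsMaxWeight (UnionIndep M ρ) c V') (z : Fin ρ) {O : Finset α}
    (hO : M.Indep (O : Set α)) :
    ∃ J : Finset (α × Fin ρ), UnionIndep (parallelCopies M ρ) ρ (J : Set (α × Fin ρ)) ∧
      (∀ p ∈ J, p.1 ∈ O ∨ p.1 ∈ V' ∧ p.2 = z) ∧
      (∀ o ∈ O, o ∈ V' → ∀ k, (o, k) ∈ J) ∧
      (ρ * ∑ o ∈ O, c o ≤ ∑ p ∈ J, c p.1) ∧
      ∀ p ∈ J, p.1 ∉ V' → c p.1 = 0 := by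
  classical
  let 𝓕 : Finset (Finset (α × Fin ρ)) := ((V' ×ˢ {z}) ∪ (O ×ˢ Finset.univ)).powerset.filter fun J =>
    UnionIndep (parallelCopies M ρ) ρ (J : Set (α × Fin ρ)) ∧
    (∀ o ∈ O, o ∈ V' → ∀ k, (o, k) ∈ J) ∧ ρ * ∑ o ∈ O, c o ≤ ∑ p ∈ J, c p.1
  have hne : 𝓕.Nonempty := by
    refine ⟨O ×ˢ Finset.univ, ?_⟩
    simp only [𝓕, Finset.mem_filter, Finset.mem_powerset]
    refine ⟨Finset.subset_union_right, ?_, by simp +contextual, ?_⟩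
    · simpa using unionIndep_prod_univ (ρ := ρ) hO
    · simp [Finset.sum_product, Finset.mul_sum]
  -- A minimiser of the number of positive-weight copies outside `V'` has none, since any such copy
  -- can be exchanged for `(v, z)` with `v ∈ V'` at least as heavy.
  obtain ⟨J, hJ, hmin⟩ := Finset.exists_min_image 𝓕
    (fun J => (J.filter fun p => p.1 ∉ V' ∧ c p.1 ≠ 0).card) hne
  simp only [𝓕, Finset.mem_filter, Finset.mem_powerset] at hJ hmin
  obtain ⟨hJG, hJi, hJO, hJw⟩ := hJ
  refine ⟨J, hJi, fun p hp => ?_, hJO, hJw, ?_⟩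
  · have := hJG hp
    simp only [Finset.mem_union, Finset.mem_product, Finset.mem_singleton, Finset.mem_univ] at this
    tauto
  rintro ⟨o, k⟩ hp ho
  by_contra hco
  dsimp only at ho hco
  have hco' : 0 < c o := lt_of_le_of_ne (hc o) (Ne.symm hco)
  have hpE : o ∈ M.E := hJi.subset_ground (Finset.mem_coe.2 hp)
  have hcl := hV'.mem_closure hpE ho hco' k z
  set N := unionMatroid (parallelCopies M ρ) ρ with hN
  have hJN : N.Indep (J : Set (α × Fin ρ)) := hJi
  obtain ⟨h, hh, hhcl⟩ : ∃ h ∈ (fun v => (v, z)) '' {v | v ∈ V' ∧ c o ≤ c v},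
      h ∉ N.closure ((J : Set (α × Fin ρ)) \ {(o, k)}) := by
    by_contra! hcon
    exact hJN.notMem_closure_sdiff_of_mem (Finset.mem_coe.2 hp)
      (N.closure_subset_closure_of_subset_closure hcon hcl)
  obtain ⟨v, ⟨hvV, hcv⟩, rfl⟩ := hh
  have hvE : (v, z) ∈ N.E := hV'.1.subset_ground (Finset.mem_coe.2 hvV)
  have hJ' : N.Indep ((J : Set (α × Fin ρ)) \ {(o, k)}) := hJN.subset sdiff_subset
  have hvJ : (v, z) ∉ (J : Set (α × Fin ρ)) \ {(o, k)} := fun hmem =>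
    hhcl (N.mem_closure_of_mem' hmem hvE)
  have hins := (hJ'.notMem_closure_iff_of_notMem hvJ hvE).1 hhcl
  have hvJ' : (v, z) ∉ J.erase (o, k) := by
    rw [← Finset.mem_coe, Finset.coe_erase]; exact hvJ
  have hlt := hmin (insert (v, z) (J.erase (o, k))) ⟨?_, ?_, ?_, ?_⟩
  · refine absurd hlt (not_le.2 (Finset.card_lt_card ⟨?_, ?_⟩))
    · intro q hq
      simp only [Finset.mem_filter, Finset.mem_insert, Finset.mem_erase] at hq ⊢
      rcases hq with ⟨rfl | hq, hq'⟩
      · exact absurd hvV hq'.1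
      · exact ⟨hq.2, hq'⟩
    · intro hsub
      have := hsub (Finset.mem_filter.2 ⟨hp, ho, hco⟩)
      simp only [Finset.mem_filter, Finset.mem_insert, Finset.mem_erase] at this
      rcases this.1 with h | h
      · have hov : o = v := congrArg Prod.fst h
        exact ho (hov ▸ hvV)
      · exact h.1 rfl
  · intro q hq
    rcases Finset.mem_insert.1 hq with rfl | hq
    · simp [hvV]
    · exact hJG (Finset.mem_of_mem_erase hq)
  · have : UnionIndep (parallelCopies M ρ) ρ _ := hins
    simpa using this
  · intro a ha haV j
    refine Finset.mem_insert_of_mem (Finset.mem_erase.2 ⟨?_, hJO a ha haV j⟩)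
    intro h
    have hao : a = o := congrArg Prod.fst h
    exact ho (hao ▸ haV)
  · rw [Finset.sum_insert hvJ']
    have := Finset.add_sum_erase J (fun p => c p.1) hp
    dsimp only at this ⊢
    linarith

/-- The elements of an independent set `O` outside a maximum-weight set `V'` can be replaced in `ρ`
disjoint ways by elements of `V'`, with no loss of weight on average. -/
theorem IsMaxWeight.exists_replacements [M.Finite] {c : α → ℝ} (hc : ∀ v, 0 ≤ c v)
    {V' : Finset α} (hV' : IsMaxWeight (UnionIndep M ρ) c V') (hρ : 0 < ρ) [DecidableEq α]
    {O : Finset α} (hO : M.Indep (O : Set α)) :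
    ∃ B : Fin ρ → Finset α, (∀ i, M.Indep (B i : Set α)) ∧ (∀ i, B i ⊆ V') ∧
      (∀ i, O ∩ V' ⊆ B i) ∧ (∀ i j v, v ∈ B i → v ∈ B j → v ∉ O → i = j) ∧
      ρ * ∑ o ∈ O \ V', c o ≤ ∑ i, ∑ v ∈ B i \ O, c v := by
  classical
  obtain ⟨J, ⟨P, hd, hPJ, hP⟩, hJG, hJO, hJw, hJ0⟩ :=
    hV'.exists_heavy_unionIndep hc ⟨0, hρ⟩ hO
  have hmem : ∀ p, p ∈ J ↔ ∃ i, p ∈ P i := fun p => by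
    rw [← Finset.mem_coe, ← hPJ, mem_iUnion]
  -- Restricting to `V'` discards only elements of weight zero.
  let B : Fin ρ → Finset α := fun i => ((J.filter (· ∈ P i)).image Prod.fst).filter (· ∈ V')
  have hB : ∀ i v, v ∈ B i ↔ v ∈ V' ∧ ∃ k, (v, k) ∈ P i := by
    intro i v
    simp only [B, Finset.mem_filter, Finset.mem_image, Prod.exists, exists_and_right,
      exists_eq_right]
    constructor
    · rintro ⟨⟨k, h⟩, hv⟩
      exact ⟨hv, k, h.2⟩
    · rintro ⟨hv, k, h⟩
      exact ⟨⟨k, (hmem _).2 ⟨i, h⟩, h⟩, hv⟩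
  have hOB : ∀ i, O ∩ V' ⊆ B i := by
    intro i o ho
    rw [Finset.mem_inter] at ho
    -- The `ρ` copies of `o` are parallel, so they lie in different parts; as there are `ρ` parts,
    -- each contains one.
    choose g hg using fun k => (hmem (o, k)).1 (hJO o ho.1 ho.2 k)
    have hginj : Function.Injective g := by
      intro a b hab
      have hb : (o, b) ∈ P (g a) := by rw [hab]; exact hg b
      have h := (hP (g a)).2 (hg a) hb rfl
      exact (Prod.ext_iff.1 h).2
    obtain ⟨k, rfl⟩ := (Finite.injective_iff_surjective.1 hginj) i
    exact (hB _ _).2 ⟨ho.2, k, hg k⟩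
  refine ⟨B, fun i => (hP i).1.subset ?_, fun i v hv => ((hB i v).1 hv).1, hOB, ?_, ?_⟩
  · intro v hv
    obtain ⟨-, k, hk⟩ := (hB i v).1 (Finset.mem_coe.1 hv)
    exact ⟨(v, k), hk, rfl⟩
  · intro i j v hi hj hvO
    obtain ⟨-, a, ha⟩ := (hB i v).1 hi
    obtain ⟨-, b, hb⟩ := (hB j v).1 hj
    -- Off `O` only the copy with index `⟨0, hρ⟩` is available, so it lies in a single part.
    have ha' := ((hJG _ ((hmem _).2 ⟨i, ha⟩)).resolve_left hvO).2
    have hb' := ((hJG _ ((hmem _).2 ⟨j, hb⟩)).resolve_left hvO).2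
    dsimp only at ha' hb'
    subst ha'
    subst hb'
    by_contra hij
    exact Set.disjoint_left.1 (hd hij) ha hb
  · have hsumJ : ∑ p ∈ J, c p.1 = ∑ i, ∑ v ∈ B i, c v := by
      have hJU : J = Finset.univ.biUnion fun i => J.filter (· ∈ P i) := by
        ext p
        simp only [Finset.mem_biUnion, Finset.mem_univ, Finset.mem_filter, true_and,
          exists_and_left]
        exact ⟨fun h => ⟨h, (hmem p).1 h⟩, fun h => h.1⟩
      rw [hJU, Finset.sum_biUnion]
      · refine Finset.sum_congr rfl fun i _ => ?_
        rw [← Finset.sum_image (f := c) (g := Prod.fst)]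
        · symm
          refine Finset.sum_filter_of_ne fun v hv hcv => ?_
          by_contra hvV
          obtain ⟨p, hp, rfl⟩ := Finset.mem_image.1 hv
          exact hcv (hJ0 p (Finset.mem_filter.1 hp).1 hvV)
        · intro p hp q hq h
          exact (hP i).2 (Finset.mem_filter.1 hp).2 (Finset.mem_filter.1 hq).2 h
      · intro i _ j _ hij
        rw [Function.onFun_apply, Finset.disjoint_left]
        intro p hp hp'
        exact Set.disjoint_left.1 (hd hij) (Finset.mem_filter.1 hp).2 (Finset.mem_filter.1 hp').2
    have hBi : ∀ i, ∑ v ∈ B i, c v = ∑ v ∈ B i \ O, c v + ∑ v ∈ O ∩ V', c v := by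
      intro i
      rw [← Finset.sum_inter_add_sum_sdiff (B i) O c, add_comm]
      congr 2
      ext v
      constructor
      · intro h
        rw [Finset.mem_inter] at h ⊢
        exact ⟨h.2, ((hB i v).1 h.1).1⟩
      · intro h
        exact Finset.mem_inter.2 ⟨hOB i h, (Finset.mem_inter.1 h).1⟩
    rw [hsumJ, Finset.sum_congr rfl fun i _ => hBi i, Finset.sum_add_distrib, Finset.sum_const,
      Finset.card_univ, Fintype.card_fin, nsmul_eq_mul] at hJw
    have := Finset.sum_inter_add_sum_sdiff O V' c
    rw [← this, mul_add] at hJw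
    linarith

end Representatives

/-! ### Swap rounding of the multilinear extension -/

section Rounding

variable {α β : Type*}

/-- The multilinear extension of the coverage function on the ground set `E`. -/
noncomputable def coverageExt (E : Finset α) (U : α → Finset β) (w : β → ℝ) (x : α → ℝ) : ℝ :=
  open Classical in ∑ u ∈ E.biUnion U, w u * (1 - ∏ v ∈ E with u ∈ U v, (1 - x v))

theorem coverageExt_mono (E : Finset α) (U : α → Finset β) {w : β → ℝ} (hw : ∀ u, 0 ≤ w u)
    {x y : α → ℝ} (hxy : x ≤ y) (hy : ∀ v, y v ≤ 1) :
    coverageExt E U w x ≤ coverageExt E U w y := by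
  classical
  refine Finset.sum_le_sum fun u _ => mul_le_mul_of_nonneg_left ?_ (hw u)
  refine sub_le_sub_left (Finset.prod_le_prod (fun v _ => ?_) fun v _ => ?_) _
  · linarith [hy v]
  · linarith [hxy v]

/-- Only the factors at `i` and `j` vary. If both occur, `(1 - x i + s) * (1 - x j - s)` has leading
term `-s ^ 2`, multiplied by the nonnegative remaining product; otherwise the dependence on `s` is
affine. -/
theorem prod_one_sub_exchange [DecidableEq α] (A : Finset α) {x : α → ℝ} (hx : ∀ v, x v ≤ 1)
    {i j : α} (hij : i ≠ j) : ∃ b c : ℝ, 0 ≤ c ∧ ∀ s : ℝ,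
      ∏ v ∈ A, (1 - (x + s • (Pi.single j 1 - Pi.single i 1 : α → ℝ)) v) =
        ∏ v ∈ A, (1 - x v) - (b * s + c * s ^ 2) := by
  have hR : ∀ s : ℝ, ∀ A' : Finset α, i ∉ A' → j ∉ A' →
      ∏ v ∈ A', (1 - (x + s • (Pi.single j 1 - Pi.single i 1 : α → ℝ)) v) =
        ∏ v ∈ A', (1 - x v) := by
    intro s A' hi hj
    refine Finset.prod_congr rfl fun v hv => ?_
    have h1 : v ≠ i := fun h => hi (h ▸ hv)
    have h2 : v ≠ j := fun h => hj (h ▸ hv)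
    simp [h1, h2]
  by_cases hi : i ∈ A <;> by_cases hj : j ∈ A
  · have hj' : j ∈ A.erase i := Finset.mem_erase.2 ⟨hij.symm, hj⟩
    refine ⟨(∏ v ∈ (A.erase i).erase j, (1 - x v)) * (x j - x i),
      ∏ v ∈ (A.erase i).erase j, (1 - x v),
      Finset.prod_nonneg fun v _ => by linarith [hx v], fun s => ?_⟩
    rw [← Finset.mul_prod_erase A _ hi, ← Finset.mul_prod_erase _ _ hj', hR s _ (by simp) (by simp),
      ← Finset.mul_prod_erase A (fun v => 1 - x v) hi, ← Finset.mul_prod_erase _ (fun v => 1 - x v) hj']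
    simp [hij, hij.symm]
    ring
  · refine ⟨-∏ v ∈ A.erase i, (1 - x v), 0, le_rfl, fun s => ?_⟩
    rw [← Finset.mul_prod_erase A _ hi, hR s _ (by simp) (by simp [hj]),
      ← Finset.mul_prod_erase A (fun v => 1 - x v) hi]
    simp [hij]
    ring
  · refine ⟨∏ v ∈ A.erase j, (1 - x v), 0, le_rfl, fun s => ?_⟩
    rw [← Finset.mul_prod_erase A _ hj, hR s _ (by simp [hi]) (by simp),
      ← Finset.mul_prod_erase A (fun v => 1 - x v) hj]
    simp [hij.symm]
    ring
  · exact ⟨0, 0, le_rfl, fun s => by rw [hR s _ hi hj]; ring⟩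

/-- The multilinear extension is convex along exchange directions. -/
theorem coverageExt_exchange [DecidableEq α] (E : Finset α) (U : α → Finset β) {w : β → ℝ}
    (hw : ∀ u, 0 ≤ w u) {x : α → ℝ} (hx : ∀ v, x v ≤ 1) {i j : α} (hij : i ≠ j) :
    ∃ b c : ℝ, 0 ≤ c ∧ ∀ s : ℝ,
      coverageExt E U w (x + s • (Pi.single j 1 - Pi.single i 1 : α → ℝ)) =
        coverageExt E U w x + b * s + c * s ^ 2 := by
  classical
  choose b c hc h using fun u : β => prod_one_sub_exchange (E.filter fun v => u ∈ U v) hx hij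
  refine ⟨∑ u ∈ E.biUnion U, w u * b u, ∑ u ∈ E.biUnion U, w u * c u,
    Finset.sum_nonneg fun u _ => mul_nonneg (hw u) (hc u), fun s => ?_⟩
  simp only [coverageExt, Finset.sum_mul]
  rw [← Finset.sum_add_distrib, ← Finset.sum_add_distrib]
  refine Finset.sum_congr (by congr) fun u _ => ?_
  have := h u s
  rw [show (∏ v ∈ E with u ∈ U v,
    (1 - (x + s • (Pi.single j 1 - Pi.single i 1 : α → ℝ)) v)) = _ by convert this]
  ring

theorem indicator_exchange [DecidableEq α] {B : Set α} {i j : α} (hi : i ∈ B) (hj : j ∉ B) :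
    (insert j (B \ {i})).indicator (1 : α → ℝ) =
      B.indicator 1 + (Pi.single j 1 - Pi.single i 1 : α → ℝ) := by
  classical
  have hij : i ≠ j := fun h => hj (h ▸ hi)
  ext v
  by_cases h1 : v = i
  · subst h1; simp [hi, hij, indicator]
  · by_cases h2 : v = j
    · subst h2; simp [hj, hij.symm, indicator]
    · simp [h1, h2, indicator]

/-- Two bases in a convex combination can be merged into one without decreasing the multilinear
extension. -/
theorem exists_merge {M : Matroid α} [M.Finite] (E : Finset α) (U : α → Finset β) {w : β → ℝ}
    (hw : ∀ u, 0 ≤ w u) {s t : ℝ} (hs : 0 ≤ s) (ht : 0 ≤ t) {y : α → ℝ}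
    (hy : ∀ v, y v + s + t ≤ 1) {B₁ B₂ : Set α} (h₁ : M.IsBase B₁) (h₂ : M.IsBase B₂) :
    ∃ B, M.IsBase B ∧
      coverageExt E U w (y + s • B₁.indicator (1 : α → ℝ) + t • B₂.indicator (1 : α → ℝ)) ≤
        coverageExt E U w (y + (s + t) • B.indicator (1 : α → ℝ)) := by
  classical
  have hfin : ∀ {X : Set α}, M.IsBase X → X.Finite := fun h =>
    M.ground_finite.subset h.subset_ground
  induction hn : (B₁ \ B₂).ncard using Nat.strong_induction_on generalizing B₁ B₂ with
  | _ n ih =>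
  by_cases hsub : B₁ ⊆ B₂
  · obtain rfl := h₁.eq_of_subset_isBase h₂ hsub
    refine ⟨B₁, h₁, le_of_eq ?_⟩
    rw [add_smul, add_assoc]
  obtain ⟨i, hi₁, hi₂⟩ := not_subset.1 hsub
  obtain ⟨j, hj, h₁', h₂'⟩ := symmetric_exchange h₁ h₂ ⟨hi₁, hi₂⟩
  have hij : i ≠ j := fun h => hi₂ (h ▸ hj.1)
  have hle : ∀ (X : Set α) v, X.indicator (1 : α → ℝ) v ≤ 1 := fun X v =>
    indicator_apply_le' (fun _ => le_rfl) fun _ => zero_le_one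
  obtain ⟨b, c, hc, hF⟩ := coverageExt_exchange E U hw
    (x := y + s • B₁.indicator (1 : α → ℝ) + t • B₂.indicator (1 : α → ℝ)) (fun v => by
      have h1 := mul_le_mul_of_nonneg_left (hle B₁ v) hs
      have h2 := mul_le_mul_of_nonneg_left (hle B₂ v) ht
      simp only [Pi.add_apply, Pi.smul_apply, smul_eq_mul]
      linarith [hy v]) hij
  -- The quadratic term never hurts, so the sign of the slope `b` decides which base to change: `B₁`
  -- by a shift `s`, or `B₂` by a shift `-t`. Both swaps shrink `B₁ \ B₂`.
  rcases le_total 0 b with hb | hb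
  · obtain ⟨B, hB, hle⟩ := ih _ (by
      rw [← hn]
      refine ncard_lt_ncard ⟨?_, fun h => ?_⟩ (hfin h₁).sdiff
      · rintro v ⟨rfl | hv, hv'⟩
        · exact absurd hj.1 hv'
        · exact ⟨hv.1, hv'⟩
      · rcases (h ⟨hi₁, hi₂⟩).1 with h | h
        · exact hij h
        · exact h.2 rfl) h₁' h₂ rfl
    refine ⟨B, hB, le_trans ?_ hle⟩
    rw [indicator_exchange hi₁ hj.2]
    have := hF s
    rw [show y + s • (B₁.indicator (1 : α → ℝ) + (Pi.single j 1 - Pi.single i 1)) +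
      t • B₂.indicator (1 : α → ℝ) = y + s • B₁.indicator (1 : α → ℝ) +
        t • B₂.indicator (1 : α → ℝ) + s • (Pi.single j 1 - Pi.single i 1) by
      rw [smul_add]; abel, this]
    have := mul_nonneg hb hs
    have := mul_nonneg hc (sq_nonneg s)
    linarith
  · obtain ⟨B, hB, hle⟩ := ih _ (by
      rw [← hn]
      refine ncard_lt_ncard ⟨?_, fun h => ?_⟩ (hfin h₁).sdiff
      · rintro v ⟨hv, hv'⟩
        refine ⟨hv, fun hv₂ => hv' (Or.inr ⟨hv₂, ?_⟩)⟩
        rintro rfl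
        exact hj.2 hv
      · exact (h ⟨hi₁, hi₂⟩).2 (Or.inl rfl)) h₁ h₂' rfl
    refine ⟨B, hB, le_trans ?_ hle⟩
    rw [indicator_exchange hj.1 hi₂]
    have := hF (-t)
    rw [show y + s • B₁.indicator (1 : α → ℝ) +
      t • (B₂.indicator (1 : α → ℝ) + (Pi.single i 1 - Pi.single j 1)) =
        y + s • B₁.indicator (1 : α → ℝ) +
        t • B₂.indicator (1 : α → ℝ) + (-t) • (Pi.single j 1 - Pi.single i 1) by
      rw [smul_add, neg_smul, ← smul_neg, neg_sub]; abel, this]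
    have := mul_nonneg (neg_nonneg.2 hb) ht
    have := mul_nonneg hc (sq_nonneg (-t))
    linarith

/-- Rounding a convex combination of bases, with equal coefficients, to a single base. -/
theorem exists_rounding {ι : Type*} {M : Matroid α} [M.Finite] (E : Finset α) (U : α → Finset β)
    {w : β → ℝ} (hw : ∀ u, 0 ≤ w u) {t : ℝ} (ht : 0 ≤ t) {B : ι → Set α}
    (hB : ∀ i, M.IsBase (B i)) (s : Finset ι) (y : α → ℝ) (hy : ∀ v, y v + s.card * t ≤ 1) :
    ∃ B', M.IsBase B' ∧
      coverageExt E U w (y + ∑ i ∈ s, t • (B i).indicator (1 : α → ℝ)) ≤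
        coverageExt E U w (y + (s.card * t) • B'.indicator (1 : α → ℝ)) := by
  classical
  induction s using Finset.induction_on generalizing y with
  | empty =>
    obtain ⟨B', hB'⟩ := M.exists_isBase
    exact ⟨B', hB', by simp⟩
  | insert a s ha ih =>
    rw [Finset.card_insert_of_notMem ha] at hy ⊢
    push_cast at hy ⊢
    -- The term of `B a` is held in the offset while the other bases merge, and is merged last.
    obtain ⟨B₂, hB₂, h₂⟩ := ih (y + t • (B a).indicator (1 : α → ℝ)) (fun v => by
      have h : (B a).indicator (1 : α → ℝ) v ≤ 1 :=
        indicator_apply_le' (fun _ => le_rfl) fun _ => zero_le_one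
      have := mul_le_mul_of_nonneg_left h ht
      simp only [Pi.add_apply, Pi.smul_apply, smul_eq_mul]
      linarith [hy v])
    obtain ⟨B', hB', h'⟩ := exists_merge E U hw ht (mul_nonneg (Nat.cast_nonneg s.card) ht)
      (y := y) (fun v => by linarith [hy v]) (hB a) hB₂
    refine ⟨B', hB', ?_⟩
    rw [Finset.sum_insert ha, ← add_assoc, show ((s.card : ℝ) + 1) * t = t + s.card * t by ring]
    exact h₂.trans h'

end Rounding

/-! ### Elementwise estimate -/

section Estimate

variable {α β : Type*}

theorem one_sub_prod_le_sum (A : Finset α) {x : α → ℝ} (h0 : ∀ v ∈ A, 0 ≤ x v)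
    (h1 : ∀ v ∈ A, x v ≤ 1) : 1 - ∏ v ∈ A, (1 - x v) ≤ ∑ v ∈ A, x v := by
  classical
  induction A using Finset.induction_on with
  | empty => simp
  | insert a A ha ih =>
    have ih := ih (fun v hv => h0 v (Finset.mem_insert_of_mem hv))
      fun v hv => h1 v (Finset.mem_insert_of_mem hv)
    have hle : ∏ v ∈ A, (1 - x v) ≤ 1 := Finset.prod_le_one
      (fun v hv => by linarith [h1 v (Finset.mem_insert_of_mem hv)])
      fun v hv => by linarith [h0 v (Finset.mem_insert_of_mem hv)]
    rw [Finset.prod_insert ha, Finset.sum_insert ha]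
    have := mul_le_mul_of_nonneg_left hle (h0 a (Finset.mem_insert_self _ _))
    linarith

/-- A lower bound for the probability that at least one of several independent events of
probability at most `t` occurs. -/
theorem mul_sum_le_one_sub_prod [DecidableEq α] (A : Finset α) {t : ℝ} (ht : t ≤ 1) {x : α → ℝ}
    (h0 : ∀ v ∈ A, 0 ≤ x v) (h1 : ∀ v ∈ A, x v ≤ t) :
    (1 - ((A.card : ℝ) - 1) * t) * ∑ v ∈ A, x v ≤ 1 - ∏ v ∈ A, (1 - x v) := by
  induction A using Finset.induction_on with
  | empty => simp
  | insert a A ha ih =>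
    have h0' : ∀ v ∈ A, 0 ≤ x v := fun v hv => h0 v (Finset.mem_insert_of_mem hv)
    have h1' : ∀ v ∈ A, x v ≤ t := fun v hv => h1 v (Finset.mem_insert_of_mem hv)
    have ih := ih h0' h1'
    have hle := one_sub_prod_le_sum A h0' fun v hv => (h1' v hv).trans ht
    have ha0 := h0 a (Finset.mem_insert_self _ _)
    have hd : ∑ v ∈ A, x v ≤ A.card * t := by
      simpa using Finset.sum_le_card_nsmul A x t h1'
    rw [Finset.prod_insert ha, Finset.sum_insert ha, Finset.card_insert_of_notMem ha]
    push_cast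
    -- The new event overlaps the earlier ones with probability at most `x a * (A.card * t)`.
    have hkey := mul_le_mul_of_nonneg_left (hle.trans hd) ha0
    have hd0 : 0 ≤ ∑ v ∈ A, x v := Finset.sum_nonneg h0'
    have ht0 : 0 ≤ t := ha0.trans (h1 a (Finset.mem_insert_self _ _))
    nlinarith [mul_nonneg ht0 hd0]

theorem coverage_eq_sum_ite (E : Finset α) (U : α → Finset β) (w : β → ℝ) {S : Finset α}
    (hS : S ⊆ E) : open Classical in coverage U w S =
      ∑ u ∈ E.biUnion U, w u * (if ∃ v ∈ S, u ∈ U v then 1 else 0) := by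
  classical
  simp only [mul_ite, mul_one, mul_zero]
  rw [← Finset.sum_filter, coverage]
  refine Finset.sum_congr ?_ fun _ _ => rfl
  ext u
  simp only [Finset.mem_biUnion, Finset.mem_filter]
  exact ⟨fun ⟨v, hv, hu⟩ => ⟨⟨v, hS hv, hu⟩, v, hv, hu⟩, fun h => h.2⟩

theorem coverage_nonneg (U : α → Finset β) {w : β → ℝ} (hw : ∀ u, 0 ≤ w u) (S : Finset α) :
    0 ≤ coverage U w S :=
  Finset.sum_nonneg fun u _ => hw u

theorem coverageExt_indicator (E : Finset α) (U : α → Finset β) (w : β → ℝ) {S : Finset α}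
    (hS : S ⊆ E) :
    coverageExt E U w ((S : Set α).indicator 1) = coverage U w S := by
  classical
  rw [coverage_eq_sum_ite E U w hS, coverageExt]
  refine Finset.sum_congr (by congr) fun u _ => ?_
  congr 1
  split_ifs with h
  · obtain ⟨v, hv, hu⟩ := h
    rw [Finset.prod_eq_zero (i := v)]
    · simp
    · simp [hS hv, hu]
    · simp [hv]
  · rw [Finset.prod_eq_one, sub_self]
    intro v hv
    have hvS : v ∉ S := fun hvS => h ⟨v, hvS, (Finset.mem_filter.1 hv).2⟩
    simp [hvS]

/-- Double counting of the pairs `(v, u)` with `u ∈ U v`. -/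
theorem sum_mul_coverage_singleton (E : Finset α) (U : α → Finset β) (w : β → ℝ) (x : α → ℝ)
    {S : Finset α} (hS : S ⊆ E) : open Classical in
    ∑ v ∈ S, x v * coverage U w {v} = ∑ u ∈ E.biUnion U, w u * ∑ v ∈ S with u ∈ U v, x v := by
  classical
  have h : ∀ v ∈ S, x v * coverage U w {v} =
      ∑ u ∈ E.biUnion U, x v * (w u * (if u ∈ U v then 1 else 0)) := by
    intro v hv
    rw [coverage_eq_sum_ite E U w (Finset.singleton_subset_iff.2 (hS hv)), Finset.mul_sum]
    simp
  rw [Finset.sum_congr rfl h, Finset.sum_comm]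
  refine Finset.sum_congr (by congr) fun u _ => ?_
  rw [Finset.sum_filter, Finset.mul_sum]
  refine Finset.sum_congr rfl fun v _ => ?_
  split_ifs <;> ring

/-- The estimate for a single element of the universe, contained in the sets indexed by `N`. -/
theorem element_estimate [DecidableEq α] {μ ρ : ℕ} (hρ : 0 < ρ) (hr : 0 ≤ 1 - ((μ : ℝ) - 1) / ρ)
    {N O V' : Finset α} (hN : N.card ≤ μ) {x : α → ℝ} (h1 : ∀ v ∈ O ∩ V', x v = 1)
    (h0 : ∀ v ∈ O \ V', x v = 0) (hx0 : ∀ v ∉ O, 0 ≤ x v) (hxρ : ∀ v ∉ O, x v ≤ 1 / ρ) :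
    (1 - ((μ : ℝ) - 1) / ρ) * ((if ∃ v ∈ O, v ∈ N then 1 else 0) + ∑ v ∈ N \ O, x v -
      ((N ∩ (O \ V')).card : ℝ)) ≤ 1 - ∏ v ∈ N, (1 - x v) := by
  have hρ' : (0 : ℝ) < ρ := by exact_mod_cast hρ
  have hρ1 : (1 : ℝ) / ρ ≤ 1 := by
    rw [div_le_one hρ']; exact_mod_cast hρ
  by_cases hk : ∃ v ∈ N, v ∈ O ∩ V'
  · obtain ⟨v, hvN, hv⟩ := hk
    rw [Finset.prod_eq_zero hvN (by rw [h1 v hv, sub_self]), sub_zero]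
    -- The covering `v` itself lies in `O`, which leaves at most `μ - 1` sets off `O`; the bound
    -- then reads `(1 - a) * (1 + a) ≤ 1` with `a = (μ - 1) / ρ`.
    have hcard : (N \ O).card + 1 ≤ μ := by
      refine le_trans ?_ hN
      refine Finset.card_lt_card (Finset.ssubset_iff_of_subset Finset.sdiff_subset |>.2 ⟨v, hvN, ?_⟩)
      simp [(Finset.mem_inter.1 hv).1]
    have hcard' : ((N \ O).card : ℝ) ≤ μ - 1 := by
      have : ((N \ O).card : ℝ) + 1 ≤ μ := by exact_mod_cast hcard
      linarith
    have hd : ∑ v ∈ N \ O, x v ≤ ((μ : ℝ) - 1) / ρ := by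
      have := Finset.sum_le_card_nsmul (N \ O) x (1 / ρ) fun v hv => hxρ v (Finset.mem_sdiff.1 hv).2
      rw [nsmul_eq_mul, mul_one_div] at this
      exact this.trans (by gcongr)
    have hle : (if ∃ v ∈ O, v ∈ N then (1 : ℝ) else 0) + ∑ v ∈ N \ O, x v -
        ((N ∩ (O \ V')).card : ℝ) ≤ 1 + ((μ : ℝ) - 1) / ρ := by
      have : (if ∃ v ∈ O, v ∈ N then (1 : ℝ) else 0) ≤ 1 := by split_ifs <;> norm_num
      have : (0 : ℝ) ≤ (N ∩ (O \ V')).card := Nat.cast_nonneg _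
      linarith
    refine (mul_le_mul_of_nonneg_left hle hr).trans ?_
    nlinarith [sq_nonneg (((μ : ℝ) - 1) / ρ)]
  · push Not at hk
    have hx : ∀ v ∈ N, 0 ≤ x v ∧ x v ≤ 1 / ρ := by
      intro v hv
      by_cases hvO : v ∈ O
      · rw [h0 v (Finset.mem_sdiff.2 ⟨hvO, fun h => hk v hv (Finset.mem_inter.2 ⟨hvO, h⟩)⟩)]
        exact ⟨le_rfl, by positivity⟩
      · exact ⟨hx0 v hvO, hxρ v hvO⟩
    have hsum : ∑ v ∈ N, x v = ∑ v ∈ N \ O, x v := by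
      rw [← Finset.sum_inter_add_sum_sdiff N O, Finset.sum_eq_zero, zero_add]
      intro v hv
      rw [Finset.mem_inter] at hv
      exact h0 v (Finset.mem_sdiff.2 ⟨hv.2, fun h => hk v hv.1 (Finset.mem_inter.2 ⟨hv.2, h⟩)⟩)
    -- Here `O` can cover only through `O \ V'`, so the subtracted count cancels the indicator and
    -- only the sum over `N \ O` remains.
    have hind : (if ∃ v ∈ O, v ∈ N then (1 : ℝ) else 0) ≤ (N ∩ (O \ V')).card := by
      split_ifs with h
      · obtain ⟨v, hvO, hvN⟩ := h
        have : 0 < (N ∩ (O \ V')).card := Finset.card_pos.2 ⟨v, Finset.mem_inter.2 ⟨hvN,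
          Finset.mem_sdiff.2 ⟨hvO, fun h => hk v hvN (Finset.mem_inter.2 ⟨hvO, h⟩)⟩⟩⟩
        exact_mod_cast this
      · exact Nat.cast_nonneg _
    have hest := mul_sum_le_one_sub_prod N hρ1 (fun v hv => (hx v hv).1) fun v hv => (hx v hv).2
    have hd0 : 0 ≤ ∑ v ∈ N, x v := Finset.sum_nonneg fun v hv => (hx v hv).1
    have hc : 1 - ((μ : ℝ) - 1) / ρ ≤ 1 - ((N.card : ℝ) - 1) * (1 / ρ) := by
      rw [mul_one_div]
      gcongr
    refine (mul_le_mul_of_nonneg_left (b := _) (c := ∑ v ∈ N, x v) ?_ hr).trans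
      ((mul_le_mul_of_nonneg_right hc hd0).trans hest)
    linarith

end Estimate

/-! ### Assembly -/

/-- Some independent subset of `V'` is at least as good, up to the factor, as a given independent
set. -/
theorem IsMaxWeight.exists_indep_coverage_ge {α β : Type*} {M : Matroid α} [M.Finite]
    {U : α → Finset β} {w : β → ℝ} (hw : ∀ u, 0 ≤ w u) {μ : ℕ} (hμ : FrequencyBounded M U μ)
    {ρ : ℕ} (hρ : 0 < ρ) {V' : Finset α}
    (hV' : IsMaxWeight (UnionIndep M ρ) (fun v => coverage U w {v}) V')
    (hr : 0 ≤ 1 - ((μ : ℝ) - 1) / ρ) {O : Finset α} (hO : M.Indep (O : Set α)) :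
    ∃ S ⊆ V', M.Indep (S : Set α) ∧
      (1 - ((μ : ℝ) - 1) / ρ) * coverage U w O ≤ coverage U w S := by
  classical
  have hρ' : (0 : ℝ) < ρ := by exact_mod_cast hρ
  let E : Finset α := M.ground_finite.toFinset
  have hE : ∀ {X : Finset α}, (X : Set α) ⊆ M.E → X ⊆ E := fun h v hv => by
    simpa [E] using h (Finset.mem_coe.2 hv)
  have hVE : (V' : Set α) ⊆ M.E := hV'.1.subset_ground
  have hOE : O ⊆ E := hE hO.subset_ground
  obtain ⟨B, hBi, hBV, hOB, hBd, hBw⟩ :=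
    hV'.exists_replacements (fun v => coverage_nonneg U hw {v}) hρ hO
  -- Rounding needs bases, so each `B i` is enlarged to a base of `M` restricted to `V'`;
  -- monotonicity of the extension permits this.
  choose B' hB' hBB' using fun i =>
    (hBi i).subset_isBasis_of_subset (Finset.coe_subset.2 (hBV i)) hVE
  have hB'base : ∀ i, (M.restrict (V' : Set α)).IsBase (B' i) := fun i =>
    (Matroid.isBase_restrict_iff hVE).2 (hB' i)
  have : (M.restrict (V' : Set α)).Finite := ⟨V'.finite_toSet⟩
  set x : α → ℝ := ∑ i : Fin ρ, (1 / ρ : ℝ) • (B i : Set α).indicator (1 : α → ℝ) with hxdef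
  have hxv : ∀ v, x v = ∑ i : Fin ρ, if v ∈ B i then (1 / ρ : ℝ) else 0 := by
    intro v
    simp [hxdef, Finset.sum_apply, indicator_apply]
  obtain ⟨S, hS, hFS⟩ := exists_rounding E U hw (t := (1 / ρ : ℝ)) (by positivity) hB'base
    Finset.univ 0 (by intro v; simp [hρ'.ne'])
  have hx1 : coverageExt E U w x ≤ coverageExt E U w
      (0 + ∑ i : Fin ρ, (1 / ρ : ℝ) • (B' i).indicator (1 : α → ℝ)) := by
    rw [zero_add]
    refine coverageExt_mono E U hw (Finset.sum_le_sum fun i _ => ?_) fun v => ?_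
    · refine smul_le_smul_of_nonneg_left ?_ (by positivity)
      exact indicator_le_indicator_of_subset (hBB' i) fun _ => zero_le_one
    · have : ∀ i ∈ (Finset.univ : Finset (Fin ρ)),
          ((1 / ρ : ℝ) • (B' i).indicator (1 : α → ℝ)) v ≤ 1 / ρ := by
        intro i _
        have h : (B' i).indicator (1 : α → ℝ) v ≤ 1 :=
          indicator_apply_le' (fun _ => le_rfl) fun _ => zero_le_one
        have := mul_le_mul_of_nonneg_left h (show (0 : ℝ) ≤ 1 / ρ by positivity)
        simpa using this
      have := Finset.sum_le_card_nsmul _ _ _ this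
      rw [Finset.sum_apply]
      simpa [hρ'.ne'] using this
  have hSb := (Matroid.isBase_restrict_iff hVE).1 hS
  have hSfin : S.Finite := V'.finite_toSet.subset hSb.subset
  lift S to Finset α using hSfin
  refine ⟨S, Finset.coe_subset.1 hSb.subset, hSb.indep, ?_⟩
  have hFS' : coverageExt E U w x ≤ coverage U w S := by
    rw [← coverageExt_indicator E U w (hE hSb.indep.subset_ground)]
    refine (hx1.trans hFS).trans (le_of_eq ?_)
    simp [hρ'.ne']
  refine le_trans ?_ hFS'
  have h1 : ∀ v ∈ O ∩ V', x v = 1 := by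
    intro v hv
    rw [hxv, Finset.sum_congr rfl fun i _ => if_pos (hOB i hv)]
    simp [hρ'.ne']
  have h0 : ∀ v ∈ O \ V', x v = 0 := by
    intro v hv
    rw [hxv]
    exact Finset.sum_eq_zero fun i _ => if_neg fun h => (Finset.mem_sdiff.1 hv).2 (hBV i h)
  have hx0 : ∀ v ∉ O, 0 ≤ x v := by
    intro v _
    rw [hxv]
    exact Finset.sum_nonneg fun i _ => by split_ifs <;> positivity
  have hxρ : ∀ v ∉ O, x v ≤ 1 / ρ := by
    intro v hv
    rw [hxv]
    by_cases h : ∃ i, v ∈ B i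
    · obtain ⟨i, hi⟩ := h
      rw [Finset.sum_eq_single i, if_pos hi]
      · exact fun j _ hj => if_neg fun hvj => hj (hBd j i v hvj hi hv)
      · simp
    · push Not at h
      rw [Finset.sum_eq_zero fun i _ => if_neg (h i)]
      positivity
  have hweight : ∑ o ∈ O \ V', coverage U w {o} ≤ ∑ v ∈ E \ O, x v * coverage U w {v} := by
    have hsw : ∑ v ∈ E \ O, x v * coverage U w {v} =
        1 / ρ * ∑ i, ∑ v ∈ B i \ O, coverage U w {v} := by
      simp only [hxv, Finset.sum_mul, Finset.mul_sum]
      rw [Finset.sum_comm]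
      refine Finset.sum_congr rfl fun i _ => ?_
      simp only [ite_mul, zero_mul]
      rw [← Finset.sum_filter]
      refine Finset.sum_congr ?_ fun _ _ => rfl
      ext v
      simp only [Finset.mem_filter, Finset.mem_sdiff]
      exact ⟨fun h => ⟨h.2, h.1.2⟩, fun h => ⟨⟨hE (hBi i).subset_ground h.1, h.2⟩, h.1⟩⟩
    rw [hsw, one_div, inv_mul_eq_div, le_div_iff₀ hρ', mul_comm]
    exact hBw
  rw [sum_mul_coverage_singleton E U w x Finset.sdiff_subset] at hweight
  have hout := sum_mul_coverage_singleton E U w 1 (S := O \ V') (Finset.sdiff_subset.trans hOE)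
  simp only [Pi.one_apply, one_mul] at hout
  rw [hout] at hweight
  -- By `hweight` the two sums inside the bracket have a nonnegative difference, so this bounds `r *
  -- coverage U w O`.
  have hmain : (1 - ((μ : ℝ) - 1) / ρ) * (coverage U w O +
      ∑ u ∈ E.biUnion U, w u * ∑ v ∈ E \ O with u ∈ U v, x v -
      ∑ u ∈ E.biUnion U, w u * ∑ v ∈ O \ V' with u ∈ U v, (1 : ℝ)) ≤ coverageExt E U w x := by
    rw [coverage_eq_sum_ite E U w hOE, coverageExt, ← Finset.sum_add_distrib,
      ← Finset.sum_sub_distrib, Finset.mul_sum]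
    refine Finset.sum_le_sum fun u _ => ?_
    have hN : (E.filter fun v => u ∈ U v).card ≤ μ := by
      have h := hμ u
      rw [show {v ∈ M.E | u ∈ U v} = ((E.filter fun v => u ∈ U v : Finset α) : Set α) by
        ext; simp [E], encard_coe_eq_coe_finsetCard] at h
      exact_mod_cast h
    have h := mul_le_mul_of_nonneg_left (element_estimate hρ hr hN h1 h0 hx0 hxρ) (hw u)
    refine le_trans (le_of_eq ?_) h
    have e1 : (∃ v ∈ O, v ∈ E.filter fun v => u ∈ U v) ↔ ∃ v ∈ O, u ∈ U v :=
      exists_congr fun v => and_congr_right fun hv => by simp [hOE hv]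
    have e2 : (E.filter fun v => u ∈ U v) \ O = (E \ O).filter fun v => u ∈ U v := by
      ext; simp; tauto
    have e3 : (E.filter fun v => u ∈ U v) ∩ (O \ V') = (O \ V').filter fun v => u ∈ U v := by
      ext v
      simp only [Finset.mem_inter, Finset.mem_filter, Finset.mem_sdiff]
      exact ⟨fun h => ⟨h.2, h.1.2⟩, fun h => ⟨⟨hOE h.1.1, h.2⟩, h.1⟩⟩
    rw [e2, e3, Finset.card_eq_sum_ones]
    simp only [e1]
    push_cast
    ring
  refine le_trans (mul_le_mul_of_nonneg_left ?_ hr) hmain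
  linarith

/-- The optimum of the coverage function over the independent sets is attained. -/
theorem exists_isGreatest_coverage {α β : Type*} (M : Matroid α) [M.Finite] (U : α → Finset β)
    (w : β → ℝ) : ∃ O : Finset α, M.Indep (O : Set α) ∧
      IsGreatest {x | ∃ T : Finset α, M.Indep (T : Set α) ∧ coverage U w T = x}
        (coverage U w O) := by
  classical
  obtain ⟨O, hO, hmax⟩ := Finset.exists_max_image
    (M.ground_finite.toFinset.powerset.filter fun T : Finset α => M.Indep (T : Set α))
    (coverage U w) ⟨∅, by simp⟩
  refine ⟨O, (Finset.mem_filter.1 hO).2, ⟨O, (Finset.mem_filter.1 hO).2, rfl⟩, ?_⟩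
  rintro _ ⟨T, hT, rfl⟩
  refine hmax T (Finset.mem_filter.2 ⟨Finset.mem_powerset.2 fun v hv => ?_, hT⟩)
  simpa using hT.subset_ground (Finset.mem_coe.2 hv)

end MatroidCoverage

theorem mainTheorem1 {α β : Type*} (M : Matroid α) [M.Finite]
    (U : α → Finset β) (w : β → ℝ) (hw : ∀ u, 0 ≤ w u)
    (μ : ℕ) (hμ : MatroidCoverage.FrequencyBounded M U μ)
    (ρ : ℕ) (hρ : 0 < ρ) (V' : Finset α)
    (hV' : MatroidCoverage.IsMaxWeight (MatroidCoverage.UnionIndep M ρ)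
      (fun v => MatroidCoverage.coverage U w {v}) V') :
    ∃ S : Finset α, S ⊆ V' ∧
      MatroidCoverage.IsApproxSolution M (MatroidCoverage.coverage U w)
        (1 - ((μ : ℝ) - 1) / (ρ : ℝ)) S := by
  obtain ⟨O, hO, hopt⟩ := MatroidCoverage.exists_isGreatest_coverage M U w
  rcases le_total 0 (1 - ((μ : ℝ) - 1) / (ρ : ℝ)) with hr | hr
  · obtain ⟨S, hSV, hSi, hS⟩ := hV'.exists_indep_coverage_ge hw hμ hρ hr hO
    exact ⟨S, hSV, hSi, _, hopt, hS⟩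
  · refine ⟨∅, Finset.empty_subset _, by simp, _, hopt, ?_⟩
    exact (mul_nonpos_of_nonpos_of_nonneg hr (MatroidCoverage.coverage_nonneg U hw O)).trans
      (MatroidCoverage.coverage_nonneg U hw ∅)
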